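/- Let $(\Gamma,d)$ be an infinite discrete metric space. For a finite set $X\subset\Gamma$ and $r>0$ put $B_r(X)=\{y\in\Gamma: d(y,X)<r\}$, and assume polynomial growth: there is $D>0$ such that for every finite $X$ there is $C>0$ with $|B_r(X)|\le C|X|(1+r)^D$ for all $r>0$. For each $x\in\Gamma$ let $d_x\ge 1$ be an integer, let $\mathcal A_X=\bigotimes_{x\in X}M_{d_x}(\mathbb C)$ for finite $X\subset\Gamma$, let $\mathcal A_{\rm loc}=\varinjlim_X\mathcal A_X$ be the direct limit along the maps $A\mapsto A\otimes 1$, and let the $C^*$-algebra $\mathcal A$ of quasi-local observables be the norm completion of $\mathcal A_{\rm loc}$. Let $\Phi$ be an interaction, that is, a family of self-adjoint $\Phi(X)\in\mathcal A_X$ indexed by the finite sets $X\subset\Gamma$, and let $\tau$ be a time evolution generated by $\Phi$: a strongly continuous one-parameter group $(\tau_t)_{t\in\mathbb R}$ of $*$-automorphisms of $\mathcal A$ such that for every $A\in\mathcal A_{\rm loc}$ the limit $\delta(A)=\lim_{\Lambda}\sum_{Z\subset\Lambda}[\Phi(Z),A]$ over the finite sets $\Lambda$ growing to $\Gamma$ exists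 and $\frac{d}{dt}\big|_{t=0}\tau_t(A)=i\,\delta(A)$. For positive constants $c,\mu,v$ consider the following two properties. * $\mathrm{LR}(c,\mu,v)$: for all finite $X,Y\subset\Gamma$ with $l=d(X,Y)>0$, all $A\in\mathcal A_X$, $B\in\mathcal A_Y$ and all $t\in\mathbb R$, $$\|[B,\tau_t(A)]\|\le c\,\|A\|\,\|B\|\,\min(|X|,|Y|)\,e^{-\mu l}\,(e^{v|t|}-1).$$ * $\mathrm{AL}(c,\mu,v)$: for every finite $X\subset\Gamma$, $A\in\mathcal A_X$ and $r>0$ there is a family $A^r(t)\in\mathcal A_{B_r(X)}$, differentiable in $t\in\mathbb R$, with $A^r(0)=A$ and, for all $t\in\mathbb R$, $$\|\tau_t(A)-A^r(t)\|\le c\,\|A\|\,|X|\,e^{-2\mu r}\,(e^{v|t|}-1).$$ The system satisfies the Lieb–Robinson bounds if $\mathrm{LR}(c,\mu,v)$ holds for some $c,\mu,v>0$, and it is approximately local if $\mathrm{AL}(c,\mu,v)$ holds for some $c,\mu,v>0$. Then the system satisfies the Lieb–Robinson bounds if and only if it is approximately local. More precisely, for all $c,\mu,v>0$: $\mathrm{LR}(c,\mu,v)$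 implies $\mathrm{AL}(c,\mu/2,v)$, and $\mathrm{AL}(c,\mu,v)$ implies $\mathrm{LR}(2c,\mu,v)$. -/

import Mathlib

noncomputable section

namespace SpinSystem

/-! ### Geometry of the lattice -/

section Geometry

variable {Γ : Type*} [MetricSpace Γ]

/-- The `r`-neighbourhood `{y | d(y, X) < r}` of a finite set `X`, as a set. -/
def nbhd (r : ℝ) (X : Finset Γ) : Set Γ := {y | ∃ x ∈ X, dist y x < r}

/-- The distance `d(X, Y) = min {d(x, y) | x ∈ X, y ∈ Y}` of two finite sets
(with value `0` if one of them is empty). -/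
def setDist (X Y : Finset Γ) : ℝ := ⨅ p : X × Y, dist (p.1 : Γ) (p.2 : Γ)

variable (Γ) in
/-- Polynomial growth: there is `D > 0` such that for every finite `X` there is `C > 0` with
`|B_r(X)| ≤ C |X| (1 + r) ^ D` for all `r > 0`; in particular `B_r(X)` is finite. -/
class PolynomialGrowth : Prop where
  exists_bound : ∃ D : ℝ, 0 < D ∧ ∀ X : Finset Γ, ∃ C : ℝ, 0 < C ∧ ∀ r : ℝ, 0 < r →
    (nbhd r X).Finite ∧ ((nbhd r X).ncard : ℝ) ≤ C * (X.card : ℝ) * (1 + r) ^ D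

theorem nbhd_finite [PolynomialGrowth Γ] (r : ℝ) (X : Finset Γ) : (nbhd r X).Finite := by
  obtain ⟨D, -, h⟩ := PolynomialGrowth.exists_bound (Γ := Γ)
  obtain ⟨C, -, h⟩ := h X
  refine (h (max r 1) (by positivity)).1.subset ?_
  rintro y ⟨x, hx, hy⟩
  exact ⟨x, hx, hy.trans_le (le_max_left _ _)⟩

/-- The ball `B_r(X) = {y | d(y, X) < r}` as a finite set. -/
def ball [PolynomialGrowth Γ] (r : ℝ) (X : Finset Γ) : Finset Γ := (nbhd_finite r X).toFinset

@[simp] theorem mem_ball [PolynomialGrowth Γ] {r : ℝ} {X : Finset Γ} {y : Γ} :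
    y ∈ ball r X ↔ ∃ x ∈ X, dist y x < r := by
  simp [ball, nbhd]

end Geometry

/-! ### Observables of finite regions -/

section Observables

open scoped Matrix.Norms.L2Operator Kronecker

variable {Γ : Type*} [DecidableEq Γ] (d : Γ → ℕ)

/-- The classical configurations on the finite region `X`; they index an orthonormal basis of
the Hilbert space `⨂_{x ∈ X} ℂ^{d x}`. -/
abbrev Conf (X : Finset Γ) : Type _ := ∀ x : X, Fin (d x)

/-- The algebra `⨂_{x ∈ X} M_{d x}(ℂ)`, as the matrices over the configurations on `X`; it
carries the operator norm. -/
abbrev MatrixAlg (X : Finset Γ) : Type _ := Matrix (Conf d X) (Conf d X) ℂ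

variable {d}

/-- A configuration on `Y` is a configuration on `X ⊆ Y` together with one on `Y \ X`. -/
def splitConf {X Y : Finset Γ} (h : X ≤ Y) :
    Conf d Y ≃ Conf d X × Conf d (Y \ X) where
  toFun σ := (fun x => σ ⟨x, h x.2⟩, fun y => σ ⟨y, (Finset.mem_sdiff.1 y.2).1⟩)
  invFun p y := if hy : (y : Γ) ∈ X then p.1 ⟨y, hy⟩
    else p.2 ⟨y, Finset.mem_sdiff.2 ⟨y.2, hy⟩⟩
  left_inv σ := by
    funext y
    by_cases hy : (y : Γ) ∈ X <;> simp [hy]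
  right_inv p := by
    refine Prod.ext ?_ ?_
    · funext x
      simp
    · funext y
      have hy : (y : Γ) ∉ X := (Finset.mem_sdiff.1 y.2).2
      simp [hy]

/-- The connecting map `A ↦ A ⊗ 1` from the matrices on `X` to those on `Y ⊇ X`. -/
def embed (X Y : Finset Γ) (h : X ≤ Y) : MatrixAlg d X →⋆ₐ[ℂ] MatrixAlg d Y where
  toFun A := (A ⊗ₖ (1 : MatrixAlg d (Y \ X))).submatrix (splitConf h) (splitConf h)
  map_one' := by simp
  map_mul' A B := by
    rw [Matrix.submatrix_mul_equiv, ← Matrix.mul_kronecker_mul, Matrix.one_mul]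
  map_zero' := by simp
  map_add' A B := by
    rw [Matrix.add_kronecker]; rfl
  commutes' r := by
    rw [Algebra.algebraMap_eq_smul_one, Matrix.smul_kronecker, Matrix.one_kronecker_one,
      Algebra.algebraMap_eq_smul_one, ← Matrix.submatrix_one_equiv (splitConf h)]
    rfl
  map_star' A := by
    simp only [Matrix.star_eq_conjTranspose]
    rw [Matrix.conjTranspose_submatrix, Matrix.conjTranspose_kronecker,
      Matrix.conjTranspose_one]

theorem embed_apply {X Y : Finset Γ} (h : X ≤ Y) (A : MatrixAlg d X) (σ τ : Conf d Y) :
    embed X Y h A σ τ = A (fun x => σ ⟨x, h x.2⟩) (fun x => τ ⟨x, h x.2⟩) *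
      (if ∀ y : Y, (y : Γ) ∉ X → σ y = τ y then 1 else 0) := by
  have : embed X Y h A σ τ = A (fun x => σ ⟨x, h x.2⟩) (fun x => τ ⟨x, h x.2⟩) *
      ((1 : MatrixAlg d (Y \ X)) (splitConf h σ).2 (splitConf h τ).2) := rfl
  rw [this, Matrix.one_apply]
  congr 1
  refine if_congr ?_ rfl rfl
  constructor
  · intro H y hy
    exact congrFun H ⟨y, Finset.mem_sdiff.2 ⟨y.2, hy⟩⟩
  · intro H
    funext y
    exact H ⟨y, (Finset.mem_sdiff.1 y.2).1⟩ (Finset.mem_sdiff.1 y.2).2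

instance directedSystem : DirectedSystem (MatrixAlg d) (fun X Y h => embed (d := d) X Y h) where
  map_self X A := by
    ext σ τ
    rw [embed_apply, if_pos fun y hy => absurd y.2 hy, mul_one]
  map_map Z Y X hXY hYZ A := by
    ext σ τ
    simp only [embed_apply, ← ite_and, mul_ite, mul_one, mul_zero]
    refine if_congr ?_ rfl rfl
    constructor
    · rintro ⟨H₁, H₂⟩ z hz
      by_cases hzY : (z : Γ) ∈ Y
      · exact H₂ ⟨z, hzY⟩ hz
      · exact H₁ z hzY
    · intro H
      exact ⟨fun z hz => H z fun hzX => hz (hXY hzX), fun y hy => H ⟨y, hYZ y.2⟩ hy⟩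

theorem embed_injective [∀ x, NeZero (d x)] {X Y : Finset Γ} (h : X ≤ Y) :
    Function.Injective (embed (d := d) X Y h) := by
  intro A B hAB
  ext σ τ
  have key := congrFun (congrFun hAB ((splitConf h).symm (σ, 0))) ((splitConf h).symm (τ, 0))
  have aux : ∀ M : MatrixAlg d X,
      embed X Y h M ((splitConf h).symm (σ, 0)) ((splitConf h).symm (τ, 0)) = M σ τ := by
    intro M
    change (M ⊗ₖ (1 : MatrixAlg d (Y \ X))) (splitConf h ((splitConf h).symm (σ, 0)))
      (splitConf h ((splitConf h).symm (τ, 0))) = M σ τ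
    rw [Equiv.apply_symm_apply, Equiv.apply_symm_apply, Matrix.kronecker_apply,
      Matrix.one_apply_eq, mul_one]
  rwa [aux, aux] at key

theorem norm_embed [∀ x, NeZero (d x)] {X Y : Finset Γ} (h : X ≤ Y) (A : MatrixAlg d X) :
    ‖embed X Y h A‖ = ‖A‖ :=
  NonUnitalStarAlgHom.norm_map _ (embed_injective h) A

/-! ### The algebra of local observables -/

variable (d)

/-- The algebra of local observables: the direct limit of the matrix algebras of the finite
regions along the maps `A ↦ A ⊗ 1`. -/
def LocalAlg : Type _ := DirectLimit (MatrixAlg d) (embed (d := d))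

instance : Ring (LocalAlg d) := inferInstanceAs (Ring (DirectLimit (MatrixAlg d) embed))
instance : StarRing (LocalAlg d) :=
  inferInstanceAs (StarRing (DirectLimit (MatrixAlg d) embed))
instance : Algebra ℂ (LocalAlg d) :=
  inferInstanceAs (Algebra ℂ (DirectLimit (MatrixAlg d) embed))
instance : StarModule ℂ (LocalAlg d) :=
  inferInstanceAs (StarModule ℂ (DirectLimit (MatrixAlg d) embed))

/-- The canonical map of the matrices on `X` into the local observables. -/
def toLocal (X : Finset Γ) : MatrixAlg d X →⋆ₐ[ℂ] LocalAlg d :=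
  { DirectLimit.Algebra.of (R := ℂ) (MatrixAlg d) embed X with
    map_star' := fun _ => rfl }

theorem toLocal_embed {X Y : Finset Γ} (h : X ≤ Y) (A : MatrixAlg d X) :
    toLocal d Y (embed X Y h A) = toLocal d X A :=
  DirectLimit.mk_apply (f := embed (d := d)) X Y A h

variable {d} in
/-- Every local observable comes from a finite region. -/
theorem LocalAlg.induction {P : LocalAlg d → Prop} (h : ∀ X A, P (toLocal d X A))
    (a : LocalAlg d) : P a :=
  DirectLimit.induction (f := embed (d := d)) h a

variable {d} in
theorem LocalAlg.induction₂ {P : LocalAlg d → LocalAlg d → Prop}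
    (h : ∀ X A B, P (toLocal d X A) (toLocal d X B)) (a b : LocalAlg d) : P a b :=
  DirectLimit.induction₂ (embed (d := d)) h a b

variable [∀ x, NeZero (d x)]

/-- The norm of a local observable is its operator norm in any finite region containing it. -/
instance : Norm (LocalAlg d) where
  norm := DirectLimit.lift (embed (d := d)) (fun _ A => ‖A‖) fun _ _ h A => (norm_embed h A).symm

theorem norm_toLocal (X : Finset Γ) (A : MatrixAlg d X) : ‖toLocal d X A‖ = ‖A‖ := rfl

theorem LocalAlg.normCore : NormedSpace.Core ℂ (LocalAlg d) where
  norm_nonneg := LocalAlg.induction fun X A => by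
    rw [norm_toLocal]; exact norm_nonneg A
  norm_smul c := LocalAlg.induction fun X A => by
    rw [← map_smul, norm_toLocal, norm_toLocal, norm_smul]
  norm_triangle := LocalAlg.induction₂ fun X A B => by
    rw [← map_add, norm_toLocal, norm_toLocal, norm_toLocal]; exact norm_add_le A B
  norm_eq_zero_iff := LocalAlg.induction fun X A => by
    constructor
    · intro h
      rw [norm_toLocal, norm_eq_zero] at h
      rw [h, map_zero]
    · intro h
      rw [h, ← map_zero (toLocal d X), norm_toLocal, norm_zero]

instance : NormedRing (LocalAlg d) where
  __ := (inferInstance : Ring (LocalAlg d))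
  __ := NormedAddCommGroup.ofCore (LocalAlg.normCore d)
  norm_mul_le := LocalAlg.induction₂ fun X A B => by
    rw [← map_mul, norm_toLocal, norm_toLocal, norm_toLocal]; exact norm_mul_le A B

instance : NormedAlgebra ℂ (LocalAlg d) where
  norm_smul_le c a := ((LocalAlg.normCore d).norm_smul c a).le

instance : CStarRing (LocalAlg d) where
  norm_mul_self_le := LocalAlg.induction fun X A => by
    rw [← map_star, ← map_mul, norm_toLocal, norm_toLocal, CStarRing.norm_star_mul_self]

/-! ### The quasi-local algebra -/

/-- The C⋆-algebra of quasi-local observables: the norm completion of the algebra of local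
observables. -/
def QuasiLocalAlg : Type _ := UniformSpace.Completion (LocalAlg d)

instance : NormedRing (QuasiLocalAlg d) :=
  inferInstanceAs (NormedRing (UniformSpace.Completion (LocalAlg d)))
instance : CompleteSpace (QuasiLocalAlg d) :=
  inferInstanceAs (CompleteSpace (UniformSpace.Completion (LocalAlg d)))
instance : NormedAlgebra ℂ (QuasiLocalAlg d) :=
  { (inferInstance : Algebra ℂ (UniformSpace.Completion (LocalAlg d))) with
    norm_smul_le := fun c (a : UniformSpace.Completion (LocalAlg d)) => norm_smul_le c a }

/-- The inclusion of the local observables into their completion. -/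
def toQuasiLocal (a : LocalAlg d) : QuasiLocalAlg d := (a : UniformSpace.Completion (LocalAlg d))

theorem denseRange_toQuasiLocal : DenseRange (toQuasiLocal d) :=
  UniformSpace.Completion.denseRange_coe

theorem norm_toQuasiLocal (a : LocalAlg d) : ‖toQuasiLocal d a‖ = ‖a‖ :=
  UniformSpace.Completion.norm_coe a

theorem continuous_toQuasiLocal : Continuous (toQuasiLocal d) :=
  UniformSpace.Completion.continuous_coe _

theorem toQuasiLocal_add (a b : LocalAlg d) :
    toQuasiLocal d (a + b) = toQuasiLocal d a + toQuasiLocal d b :=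
  UniformSpace.Completion.coe_add a b

theorem toQuasiLocal_mul (a b : LocalAlg d) :
    toQuasiLocal d (a * b) = toQuasiLocal d a * toQuasiLocal d b :=
  UniformSpace.Completion.coe_mul a b

theorem toQuasiLocal_smul (c : ℂ) (a : LocalAlg d) :
    toQuasiLocal d (c • a) = c • toQuasiLocal d a :=
  UniformSpace.Completion.coe_smul c a

/-- The adjoint, extended by continuity from the local observables. -/
instance : Star (QuasiLocalAlg d) where
  star := UniformSpace.Completion.map (star : LocalAlg d → LocalAlg d)

theorem continuous_star_quasiLocal : Continuous (star : QuasiLocalAlg d → QuasiLocalAlg d) :=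
  UniformSpace.Completion.continuous_map

theorem toQuasiLocal_star (a : LocalAlg d) :
    toQuasiLocal d (star a) = star (toQuasiLocal d a) :=
  (UniformSpace.Completion.map_coe (star_isometry (E := LocalAlg d)).uniformContinuous a).symm

variable {d} in
theorem QuasiLocalAlg.induction {P : QuasiLocalAlg d → Prop} (hP : IsClosed {a | P a})
    (h : ∀ a, P (toQuasiLocal d a)) (a : QuasiLocalAlg d) : P a :=
  UniformSpace.Completion.induction_on a hP h

variable {d} in
theorem QuasiLocalAlg.induction₂ {P : QuasiLocalAlg d → QuasiLocalAlg d → Prop}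
    (hP : IsClosed {p : QuasiLocalAlg d × QuasiLocalAlg d | P p.1 p.2})
    (h : ∀ a b, P (toQuasiLocal d a) (toQuasiLocal d b)) (a b : QuasiLocalAlg d) : P a b :=
  UniformSpace.Completion.induction_on₂ a b hP h

instance : StarRing (QuasiLocalAlg d) where
  star_involutive := by
    have hc := continuous_star_quasiLocal d
    refine QuasiLocalAlg.induction (isClosed_eq (hc.comp hc) continuous_id) fun a => ?_
    rw [← toQuasiLocal_star, ← toQuasiLocal_star, star_star]
  star_mul := by
    have hc := continuous_star_quasiLocal d
    refine QuasiLocalAlg.induction₂ (isClosed_eq (by fun_prop) (by fun_prop)) fun a b => ?_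
    rw [← toQuasiLocal_mul, ← toQuasiLocal_star, star_mul, toQuasiLocal_mul, toQuasiLocal_star,
      toQuasiLocal_star]
  star_add := by
    have hc := continuous_star_quasiLocal d
    refine QuasiLocalAlg.induction₂ (isClosed_eq (by fun_prop) (by fun_prop)) fun a b => ?_
    rw [← toQuasiLocal_add, ← toQuasiLocal_star, star_add, toQuasiLocal_add, toQuasiLocal_star,
      toQuasiLocal_star]

instance : StarModule ℂ (QuasiLocalAlg d) where
  star_smul c := by
    have hc := continuous_star_quasiLocal d
    refine QuasiLocalAlg.induction (isClosed_eq (hc.comp (continuous_const_smul c))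
      (hc.const_smul (star c))) fun a => ?_
    rw [← toQuasiLocal_smul, ← toQuasiLocal_star, star_smul, toQuasiLocal_smul,
      toQuasiLocal_star]

instance : CStarRing (QuasiLocalAlg d) where
  norm_mul_self_le := by
    have hc := continuous_star_quasiLocal d
    refine QuasiLocalAlg.induction (isClosed_le (by fun_prop) (by fun_prop)) fun a => ?_
    rw [← toQuasiLocal_star, ← toQuasiLocal_mul, norm_toQuasiLocal, norm_toQuasiLocal,
      CStarRing.norm_star_mul_self]

instance : CStarAlgebra (QuasiLocalAlg d) where

/-- The inclusion of the matrix algebra of a finite region into the quasi-local algebra. -/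
def toObs (X : Finset Γ) : MatrixAlg d X →⋆ₐ[ℂ] QuasiLocalAlg d where
  toFun A := toQuasiLocal d (toLocal d X A)
  map_one' := by rw [map_one]; rfl
  map_mul' A B := by rw [map_mul, toQuasiLocal_mul]
  map_zero' := by rw [map_zero]; rfl
  map_add' A B := by rw [map_add, toQuasiLocal_add]
  commutes' c := by
    rw [Algebra.algebraMap_eq_smul_one, map_smul, map_one, toQuasiLocal_smul,
      Algebra.algebraMap_eq_smul_one]
    rfl
  map_star' A := by rw [map_star, toQuasiLocal_star]

theorem norm_toObs (X : Finset Γ) (A : MatrixAlg d X) : ‖toObs d X A‖ = ‖A‖ :=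
  norm_toQuasiLocal d _

theorem toObs_embed {X Y : Finset Γ} (h : X ≤ Y) (A : MatrixAlg d X) :
    toObs d Y (embed X Y h A) = toObs d X A :=
  congrArg (toQuasiLocal d) (toLocal_embed d h A)

/-- The algebra `𝒜_X` of observables of the finite region `X`, inside the quasi-local algebra. -/
def obs (X : Finset Γ) : StarSubalgebra ℂ (QuasiLocalAlg d) := (toObs d X).range

/-! ### Interactions and time evolutions -/

/-- An interaction: a self-adjoint observable `Φ X ∈ 𝒜_X` for every finite region `X`. -/
structure Interaction where
  /-- The interaction term of the finite region `X`. -/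
  term : Finset Γ → QuasiLocalAlg d
  isSelfAdjoint : ∀ X, IsSelfAdjoint (term X)
  mem_obs : ∀ X, term X ∈ obs d X

variable {d}

/-- `D` is the value at `A` of the derivation of the interaction:
`D = lim_Λ ∑_{Z ⊆ Λ} [Φ Z, A]`, as the finite region `Λ` grows to the whole lattice. -/
def Interaction.HasDerivation (Φ : Interaction d) (A D : QuasiLocalAlg d) : Prop :=
  Filter.Tendsto (fun Λ : Finset Γ => ∑ Z ∈ Λ.powerset, (Φ.term Z * A - A * Φ.term Z))
    Filter.atTop (nhds D)

/-- A time evolution generated by the interaction `Φ`: a strongly continuous one-parameter group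
of ⋆-automorphisms of the quasi-local algebra, whose generator is defined on every local
observable `A` and is there `i` times the derivation of `Φ`, that is,
`d/dt τ_t(A) = i lim_Λ ∑_{Z ⊆ Λ} [Φ Z, A]` at `t = 0`. -/
structure TimeEvolution (Φ : Interaction d) where
  /-- The automorphism `τ_t`. -/
  aut : ℝ → (QuasiLocalAlg d ≃⋆ₐ[ℂ] QuasiLocalAlg d)
  aut_zero : ∀ A, aut 0 A = A
  aut_add : ∀ s t A, aut (s + t) A = aut s (aut t A)
  continuous_aut : ∀ A, Continuous fun t => aut t A
  generator : ∀ (X : Finset Γ), ∀ A ∈ obs d X, ∃ D, Φ.HasDerivation A D ∧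
    HasDerivAt (fun t : ℝ => aut t A) (Complex.I • D) 0

end Observables

/-! ### Lieb-Robinson bounds and approximate locality -/

section Locality

variable {Γ : Type*} [MetricSpace Γ] [DecidableEq Γ] {d : Γ → ℕ} [∀ x, NeZero (d x)]
  {Φ : Interaction d}

/-- The Lieb-Robinson bound with constants `c`, `μ`, `v`: for all observables `A ∈ 𝒜_X` and
`B ∈ 𝒜_Y` of finite regions at distance `l = d(X, Y) > 0` and all times `t`,
`‖[B, τ_t(A)]‖ ≤ c ‖A‖ ‖B‖ min(|X|, |Y|) e^{-μ l} (e^{v |t|} - 1)`. -/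
def TimeEvolution.LiebRobinsonWith (τ : TimeEvolution Φ) (c μ v : ℝ) : Prop :=
  ∀ X Y : Finset Γ, 0 < setDist X Y → ∀ A ∈ obs d X, ∀ B ∈ obs d Y, ∀ t : ℝ,
    ‖B * τ.aut t A - τ.aut t A * B‖ ≤
      c * ‖A‖ * ‖B‖ * min (X.card : ℝ) (Y.card : ℝ) * Real.exp (-μ * setDist X Y) *
        (Real.exp (v * |t|) - 1)

/-- The Lieb-Robinson bound, for some positive constants. -/
def TimeEvolution.LiebRobinson (τ : TimeEvolution Φ) : Prop :=
  ∃ c μ v : ℝ, 0 < c ∧ 0 < μ ∧ 0 < v ∧ τ.LiebRobinsonWith c μ v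

/-- Approximate locality with constants `c`, `μ`, `v`: for every `A ∈ 𝒜_X` and `r > 0` there is a
family `A^r(t) ∈ 𝒜_{B_r(X)}`, differentiable in `t ∈ ℝ`, with `A^r(0) = A` and
`‖τ_t(A) - A^r(t)‖ ≤ c ‖A‖ |X| e^{-2 μ r} (e^{v |t|} - 1)` for all `t`. -/
def TimeEvolution.ApproxLocalWith [PolynomialGrowth Γ] (τ : TimeEvolution Φ) (c μ v : ℝ) : Prop :=
  ∀ X : Finset Γ, ∀ A ∈ obs d X, ∀ r : ℝ, 0 < r → ∃ Ar : ℝ → QuasiLocalAlg d,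
    (∀ t, Ar t ∈ obs d (ball r X)) ∧ Differentiable ℝ Ar ∧ Ar 0 = A ∧
    ∀ t : ℝ, ‖τ.aut t A - Ar t‖ ≤
      c * ‖A‖ * (X.card : ℝ) * Real.exp (-2 * μ * r) * (Real.exp (v * |t|) - 1)

/-- Approximate locality, for some positive constants. -/
def TimeEvolution.ApproxLocal [PolynomialGrowth Γ] (τ : TimeEvolution Φ) : Prop :=
  ∃ c μ v : ℝ, 0 < c ∧ 0 < μ ∧ 0 < v ∧ τ.ApproxLocalWith c μ v

end Locality

end SpinSystem

end

/-!
The bridge between the two properties is the conditional expectation `expectation d X` of the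
quasi-local algebra onto the observables of a finite region `X`: the normalised partial trace
over the complement of `X`. On the matrices of a region `Z ⊇ X` it is the average of
`T ↦ W T W⋆` over the Weyl unitaries `W` of `Z \ X` (`embed_restrict`). Hence it is contractive,
uniformly in `Z`, and so extends to the completion. Moreover, an element whose commutators with
the normalised observables of all regions outside `X` are at most `K` has distance at most `K`
from its conditional expectation (`norm_sub_toObs_expectation_le`).

*Lieb-Robinson implies approximate locality.* Take for `A^r(t)` the conditional expectation of
`τ_t(A)` onto `B_r(X)`. A region outside `B_r(X)` has distance at least `r` from `X`, so the
Lieb-Robinson bound controls these commutators by `e^{-μ r}`. The family is differentiable since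
the conditional expectation is linear and bounded and `A` is in the domain of the generator.

*Approximate locality implies Lieb-Robinson.* For `r = d(X, Y)` the ball `B_r(X)` is disjoint
from `Y`, so `B ∈ 𝒜_Y` commutes with `A^r(t)` and `[B, τ_t(A)] = [B, τ_t(A) - A^r(t)]`, which gives
the bound with the factor `|X|`. Since `τ_t` is isometric, `‖[B, τ_t(A)]‖ = ‖[A, τ_{-t}(B)]‖`, and
exchanging the roles of `A` and `B` gives the bound with `|Y|`.
-/

noncomputable section

namespace SpinSystem

/-! ### Averaging over Weyl unitaries -/

section Matrices

open scoped Matrix.Norms.L2Operator Kronecker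

variable {m n : Type*} [Fintype m] [DecidableEq m] [Fintype n] [DecidableEq n]

/-- The Weyl matrix of a translation `g` and a character `ψ` of a finite abelian group `n`: the
translation by `g` on functions on `n`, followed by multiplication by `ψ`. -/
def weyl [AddCommGroup n] (g : n) (ψ : AddChar n ℂ) : Matrix n n ℂ :=
  Matrix.of fun i j => if i + g = j then ψ i else 0

theorem weyl_mem_unitary [AddCommGroup n] (g : n) (ψ : AddChar n ℂ) :
    weyl g ψ ∈ unitary (Matrix n n ℂ) := by
  have h : weyl g ψ * star (weyl g ψ) = 1 := by
    ext i j
    simp only [weyl, Matrix.star_eq_conjTranspose, Matrix.mul_apply, Matrix.of_apply,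
      Matrix.conjTranspose_apply, Matrix.one_apply, ite_mul, zero_mul, Finset.sum_ite_eq,
      Finset.mem_univ, if_true, apply_ite star, star_zero, mul_ite, mul_zero, add_left_inj]
    refine if_ctx_congr Iff.rfl (fun hij => ?_) fun _ => rfl
    rw [hij, Complex.star_def, ← AddChar.map_neg_eq_conj, ← AddChar.map_add_eq_mul,
      add_neg_cancel, AddChar.map_zero_eq_one]
  exact Unitary.mem_iff.2 ⟨mul_eq_one_comm.1 h, h⟩

/-- The normalised partial trace over the second tensor factor. -/
def normalizedPartialTrace (m n : Type*) [Fintype n] :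
    Matrix (m × n) (m × n) ℂ →ₗ[ℂ] Matrix m m ℂ where
  toFun T := Matrix.of fun i j => (Fintype.card n : ℂ)⁻¹ * ∑ k, T (i, k) (j, k)
  map_add' S T := by
    ext i j
    simp [Finset.sum_add_distrib, mul_add]
  map_smul' c T := by
    ext i j
    simp [← Finset.mul_sum, mul_left_comm]

theorem normalizedPartialTrace_apply {m n : Type*} [Fintype n]
    (T : Matrix (m × n) (m × n) ℂ) (i j : m) :
    normalizedPartialTrace m n T i j = (Fintype.card n : ℂ)⁻¹ * ∑ k, T (i, k) (j, k) := rfl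

theorem one_kronecker_weyl_mul_mul_apply [AddCommGroup n] (g : n) (ψ : AddChar n ℂ)
    (T : Matrix (m × n) (m × n) ℂ) (i j : m) (k l : n) :
    (((1 : Matrix m m ℂ) ⊗ₖ weyl g ψ) * T * star ((1 : Matrix m m ℂ) ⊗ₖ weyl g ψ))
      (i, k) (j, l) = ψ (k - l) * T (i, k + g) (j, l + g) := by
  simp only [Matrix.mul_apply, Fintype.sum_prod_type, Matrix.star_eq_conjTranspose,
    Matrix.conjTranspose_apply, Matrix.kronecker_apply, weyl, Matrix.of_apply, Matrix.one_apply,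
    ite_mul, mul_ite, one_mul, zero_mul, mul_zero, apply_ite star, star_zero,
    Finset.sum_ite_eq, Finset.mem_univ, if_true]
  rw [sub_eq_add_neg, AddChar.map_add_eq_mul, AddChar.map_neg_eq_conj, Complex.star_def]
  ring

/-- Averaging over the characters kills the entries off the diagonal of the second factor, by
orthogonality; averaging over the translations makes the diagonal constant. -/
theorem normalizedPartialTrace_kronecker_one [AddCommGroup n] (T : Matrix (m × n) (m × n) ℂ) :
    normalizedPartialTrace m n T ⊗ₖ (1 : Matrix n n ℂ) =
      (Fintype.card (n × AddChar n ℂ) : ℂ)⁻¹ • ∑ w : n × AddChar n ℂ,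
        ((1 : Matrix m m ℂ) ⊗ₖ weyl w.1 w.2) * T * star ((1 : Matrix m m ℂ) ⊗ₖ weyl w.1 w.2) := by
  ext ⟨i, k⟩ ⟨j, l⟩
  have hn : (Fintype.card n : ℂ) ≠ 0 := Nat.cast_ne_zero.2 Fintype.card_ne_zero
  rw [Matrix.smul_apply, Matrix.sum_apply, Fintype.sum_prod_type]
  simp only [one_kronecker_weyl_mul_mul_apply, ← Finset.sum_mul, AddChar.sum_apply_eq_ite,
    sub_eq_zero]
  rw [Matrix.kronecker_apply, Matrix.one_apply, normalizedPartialTrace_apply, Fintype.card_prod,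
    AddChar.card_eq]
  split_ifs with hkl
  · subst hkl
    have hshift : ∑ g, T (i, k + g) (j, k + g) = ∑ g, T (i, g) (j, g) :=
      Equiv.sum_comp (Equiv.addLeft k) fun g => T (i, g) (j, g)
    rw [← Finset.mul_sum, hshift]
    push_cast
    rw [smul_eq_mul]
    field_simp
  · simp

/-- Averaging over a finite family of unitaries is a contraction, and it moves an element by no
more than the commutators with these unitaries. -/
theorem norm_average_unitary {A ι : Type*} [NormedRing A] [NormedAlgebra ℂ A] [StarRing A]
    [CStarRing A] [Fintype ι] [Nonempty ι] (u : ι → A) (hu : ∀ i, u i ∈ unitary A) (T : A) :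
    ‖(Fintype.card ι : ℂ)⁻¹ • ∑ i, u i * T * star (u i)‖ ≤ ‖T‖ ∧
    ∀ K : ℝ, (∀ i, ‖u i * T - T * u i‖ ≤ K) →
      ‖T - (Fintype.card ι : ℂ)⁻¹ • ∑ i, u i * T * star (u i)‖ ≤ K := by
  have hn : (Fintype.card ι : ℂ) ≠ 0 := Nat.cast_ne_zero.2 Fintype.card_ne_zero
  have hn' : (0 : ℝ) < Fintype.card ι := Nat.cast_pos.2 Fintype.card_pos
  have key : ∀ (f : ι → A) (K : ℝ), (∀ i, ‖f i‖ ≤ K) →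
      ‖(Fintype.card ι : ℂ)⁻¹ • ∑ i, f i‖ ≤ K := by
    intro f K hf
    rw [norm_smul, norm_inv, Complex.norm_natCast, inv_mul_le_iff₀ hn']
    refine (norm_sum_le _ _).trans ((Finset.sum_le_sum fun i _ => hf i).trans_eq ?_)
    rw [Finset.sum_const, nsmul_eq_mul, Finset.card_univ]
  refine ⟨key _ _ fun i => ?_, fun K hK => ?_⟩
  · rw [CStarRing.norm_mul_mem_unitary _ (Unitary.star_mem (hu i)),
      CStarRing.norm_mem_unitary_mul _ (hu i)]
  · have hT : T - (Fintype.card ι : ℂ)⁻¹ • ∑ i, u i * T * star (u i) =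
        (Fintype.card ι : ℂ)⁻¹ • ∑ i, (T * u i - u i * T) * star (u i) := by
      simp only [sub_mul, mul_assoc, Unitary.mul_star_self_of_mem (hu _), mul_one,
        Finset.sum_sub_distrib, Finset.sum_const, Finset.card_univ, smul_sub]
      rw [← Nat.cast_smul_eq_nsmul ℂ, smul_smul, inv_mul_cancel₀ hn, one_smul]
    rw [hT]
    refine key _ _ fun i => ?_
    rw [CStarRing.norm_mul_mem_unitary _ (Unitary.star_mem (hu i)), norm_sub_rev]
    exact hK i

end Matrices

/-! ### The conditional expectation onto a finite region -/

section Expectation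

open scoped Matrix.Norms.L2Operator Kronecker

variable {Γ : Type*} [DecidableEq Γ] {d : Γ → ℕ}

theorem embed_sdiff_eq {X Y : Finset Γ} (h : X ≤ Y) (W : MatrixAlg d (Y \ X)) :
    embed (Y \ X) Y Finset.sdiff_subset W =
      ((1 : MatrixAlg d X) ⊗ₖ W).submatrix (splitConf h) (splitConf h) := by
  ext σ τ
  rw [embed_apply, Matrix.submatrix_apply, Matrix.kroneckerMap_apply, Matrix.one_apply, mul_comm]
  congr 1
  refine if_congr ⟨fun H => funext fun x => H ⟨x, h x.2⟩ ?_, fun H y hy => ?_⟩ rfl rfl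
  · exact fun hx => (Finset.mem_sdiff.1 hx).2 x.2
  · have hyX : (y : Γ) ∈ X := by_contra fun hX => hy (Finset.mem_sdiff.2 ⟨y.2, hX⟩)
    exact congrFun H ⟨y, hyX⟩

theorem embed_embed {X Y Z : Finset Γ} (hXY : X ≤ Y) (hYZ : Y ≤ Z) (A : MatrixAlg d X) :
    embed Y Z hYZ (embed X Y hXY A) = embed X Z (hXY.trans hYZ) A :=
  directedSystem.map_map hXY hYZ A

theorem commute_embed {X Y Z : Finset Γ} (hX : X ≤ Z) (hY : Y ≤ Z) (hXY : Disjoint X Y)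
    (A : MatrixAlg d X) (B : MatrixAlg d Y) : Commute (embed X Z hX A) (embed Y Z hY B) := by
  have hYX : Y ≤ Z \ X := Finset.subset_sdiff.2 ⟨hY, hXY.symm⟩
  have hB : embed Y Z hY B =
      ((1 : MatrixAlg d X) ⊗ₖ embed Y (Z \ X) hYX B).submatrix (splitConf hX) (splitConf hX) := by
    rw [← embed_sdiff_eq hX, embed_embed]
  have hA : embed X Z hX A =
      (A ⊗ₖ (1 : MatrixAlg d (Z \ X))).submatrix (splitConf hX) (splitConf hX) := rfl
  rw [hA, hB, Commute, SemiconjBy, Matrix.submatrix_mul_equiv, Matrix.submatrix_mul_equiv,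
    ← Matrix.mul_kronecker_mul, ← Matrix.mul_kronecker_mul, Matrix.one_mul, Matrix.mul_one,
    Matrix.one_mul, Matrix.mul_one]

/-- The conditional expectation from the matrices on `Y` to those on `X ⊆ Y`: the normalised
partial trace over `Y \ X`. -/
def restrict {X Y : Finset Γ} (h : X ≤ Y) : MatrixAlg d Y →ₗ[ℂ] MatrixAlg d X :=
  normalizedPartialTrace (Conf d X) (Conf d (Y \ X)) ∘ₗ
    (Matrix.reindexLinearEquiv ℂ ℂ (splitConf h) (splitConf h)).toLinearMap

theorem restrict_apply {X Y : Finset Γ} (h : X ≤ Y) (T : MatrixAlg d Y) (σ τ : Conf d X) :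
    restrict h T σ τ = (Fintype.card (Conf d (Y \ X)) : ℂ)⁻¹ *
      ∑ ρ, T ((splitConf h).symm (σ, ρ)) ((splitConf h).symm (τ, ρ)) := rfl

theorem restrict_refl (X : Finset Γ) (T : MatrixAlg d X) : restrict (le_refl X) T = T := by
  ext σ τ
  have : IsEmpty (X \ X : Finset Γ) := ⟨fun x => by simpa using x.2⟩
  have hs : ∀ (σ : Conf d X) (ρ : Conf d (X \ X)), (splitConf le_rfl).symm (σ, ρ) = σ :=
    fun σ ρ => funext fun x => dif_pos x.2
  simp [restrict_apply, hs]

variable [∀ x, NeZero (d x)]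

/-- Enlarging the region by a tensor factor `1` does not change the normalised partial trace. -/
theorem restrict_embed {X Y Z : Finset Γ} (hXY : X ≤ Y) (hYZ : Y ≤ Z) (T : MatrixAlg d Y) :
    restrict (hXY.trans hYZ) (embed Y Z hYZ T) = restrict hXY T := by
  ext σ τ
  have hs : Y \ X ≤ Z \ X := Finset.sdiff_subset_sdiff hYZ le_rfl
  have hcard : Fintype.card (Conf d (Z \ X)) = Fintype.card (Conf d (Y \ X)) *
      Fintype.card (Conf d ((Z \ X) \ (Y \ X))) := by
    rw [Fintype.card_congr (splitConf (d := d) hs), Fintype.card_prod]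
  have hterm : ∀ ρ : Conf d (Z \ X),
      embed Y Z hYZ T ((splitConf (hXY.trans hYZ)).symm (σ, ρ))
        ((splitConf (hXY.trans hYZ)).symm (τ, ρ)) =
      T ((splitConf hXY).symm (σ, (splitConf hs ρ).1))
        ((splitConf hXY).symm (τ, (splitConf hs ρ).1)) := by
    intro ρ
    rw [embed_apply, if_pos, mul_one]
    · rfl
    · intro z hz
      have hzX : (z : Γ) ∉ X := fun h => hz (hXY h)
      simp [splitConf, hzX]
  have hN : (Fintype.card (Conf d ((Z \ X) \ (Y \ X))) : ℂ) ≠ 0 :=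
    Nat.cast_ne_zero.2 Fintype.card_ne_zero
  rw [restrict_apply, restrict_apply, Finset.sum_congr rfl fun ρ _ => hterm ρ,
    (splitConf hs).sum_comp fun p => T ((splitConf hXY).symm (σ, p.1))
      ((splitConf hXY).symm (τ, p.1)), Fintype.sum_prod_type, hcard]
  simp only [Finset.sum_const, Finset.card_univ, nsmul_eq_mul, ← Finset.mul_sum]
  push_cast
  rw [mul_inv, mul_assoc, inv_mul_cancel_left₀ hN]

theorem embed_restrict {X Y : Finset Γ} (h : X ≤ Y) (T : MatrixAlg d Y) :
    embed X Y h (restrict h T) =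
      (Fintype.card (Conf d (Y \ X) × AddChar (Conf d (Y \ X)) ℂ) : ℂ)⁻¹ •
        ∑ w : Conf d (Y \ X) × AddChar (Conf d (Y \ X)) ℂ,
          embed (Y \ X) Y Finset.sdiff_subset (weyl w.1 w.2) * T *
            star (embed (Y \ X) Y Finset.sdiff_subset (weyl w.1 w.2)) := by
  have hT : T = (T.submatrix (splitConf h).symm (splitConf h).symm).submatrix
      (splitConf h) (splitConf h) := by simp
  have hE : embed X Y h (restrict h T) =
      (normalizedPartialTrace _ _ (T.submatrix (splitConf h).symm (splitConf h).symm) ⊗ₖ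
        (1 : MatrixAlg d (Y \ X))).submatrix (splitConf h) (splitConf h) := rfl
  rw [hE, normalizedPartialTrace_kronecker_one]
  ext σ τ
  simp only [Matrix.submatrix_apply, Matrix.smul_apply, Matrix.sum_apply]
  congr 1
  refine Finset.sum_congr rfl fun w _ => ?_
  rw [embed_sdiff_eq h]
  conv_rhs => rw [hT]
  rw [Matrix.star_eq_conjTranspose, Matrix.star_eq_conjTranspose, Matrix.conjTranspose_submatrix,
    Matrix.submatrix_mul_equiv, Matrix.submatrix_mul_equiv, Matrix.submatrix_apply]

theorem embed_weyl_mem_unitary {Y Z : Finset Γ} (h : Y ≤ Z) (g : Conf d Y)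
    (ψ : AddChar (Conf d Y) ℂ) : embed Y Z h (weyl g ψ) ∈ unitary (MatrixAlg d Z) :=
  Unitary.map_mem _ (weyl_mem_unitary g ψ)

theorem norm_restrict_le {X Y : Finset Γ} (h : X ≤ Y) (T : MatrixAlg d Y) :
    ‖restrict h T‖ ≤ ‖T‖ := by
  have hu : ∀ w : Conf d (Y \ X) × AddChar (Conf d (Y \ X)) ℂ,
      embed (Y \ X) Y Finset.sdiff_subset (weyl w.1 w.2) ∈ unitary (MatrixAlg d Y) :=
    fun w => embed_weyl_mem_unitary _ w.1 w.2
  rw [← norm_embed h, embed_restrict]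
  exact (norm_average_unitary _ hu T).1

variable (d)

/-- The conditional expectation of the local observables onto the region `X`. An observable of
the region `Z` is first regarded as one of `X ∪ Z`. -/
def localExpectation (X : Finset Γ) : LocalAlg d →ₗ[ℂ] MatrixAlg d X :=
  DirectLimit.Module.lift ℂ (Finset Γ) (MatrixAlg d) (embed (d := d))
    (fun Z => restrict (Finset.subset_union_left (s₂ := Z)) ∘ₗ
      (embed Z (X ∪ Z) Finset.subset_union_right).toAlgHom.toLinearMap)
    fun Y Z h T => by
      change restrict _ (embed Z (X ∪ Z) _ (embed Y Z h T)) = restrict _ (embed Y (X ∪ Y) _ T)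
      rw [embed_embed, ← restrict_embed Finset.subset_union_left
        (Finset.union_subset_union_right h), embed_embed]

theorem localExpectation_toLocal {X Z : Finset Γ} (h : X ≤ Z) (T : MatrixAlg d Z) :
    localExpectation d X (toLocal d Z T) = restrict h T := by
  have : localExpectation d X (toLocal d Z T) = restrict (Finset.subset_union_left (s₁ := X))
      (embed Z (X ∪ Z) Finset.subset_union_right T) := rfl
  rw [this]
  exact restrict_embed h Finset.subset_union_right T

theorem norm_localExpectation_le (X : Finset Γ) (a : LocalAlg d) :
    ‖localExpectation d X a‖ ≤ ‖a‖ := by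
  induction a using LocalAlg.induction with
  | h Z T =>
    rw [← toLocal_embed d (Finset.subset_union_right (s₁ := X)) T,
      localExpectation_toLocal d Finset.subset_union_left, norm_toLocal]
    exact norm_restrict_le _ _

/-- The inclusion of the local observables into the quasi-local algebra as a linear map. -/
def toQuasiLocalₗ : LocalAlg d →ₗ[ℂ] QuasiLocalAlg d where
  toFun := toQuasiLocal d
  map_add' := toQuasiLocal_add d
  map_smul' := toQuasiLocal_smul d

/-- The conditional expectation of the quasi-local algebra onto the region `X`, extended by
continuity from the local observables. It is the normalised partial trace over the complement
of `X`. -/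
def expectation (X : Finset Γ) : QuasiLocalAlg d →L[ℂ] MatrixAlg d X :=
  (localExpectation d X).extendOfNorm (toQuasiLocalₗ d)

theorem norm_localExpectation_le_toQuasiLocal (X : Finset Γ) (a : LocalAlg d) :
    ‖localExpectation d X a‖ ≤ 1 * ‖toQuasiLocalₗ d a‖ := by
  rw [one_mul]
  exact (norm_localExpectation_le d X a).trans_eq (norm_toQuasiLocal d a).symm

theorem expectation_toObs {X Z : Finset Γ} (h : X ≤ Z) (T : MatrixAlg d Z) :
    expectation d X (toObs d Z T) = restrict h T := by
  rw [← localExpectation_toLocal d h]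
  exact LinearMap.extendOfNorm_eq (denseRange_toQuasiLocal d)
    ⟨1, norm_localExpectation_le_toQuasiLocal d X⟩ (toLocal d Z T)

theorem norm_expectation_le (X : Finset Γ) (a : QuasiLocalAlg d) : ‖expectation d X a‖ ≤ ‖a‖ := by
  have := LinearMap.norm_extendOfNorm_apply_le (denseRange_toQuasiLocal d) 1
    (norm_localExpectation_le_toQuasiLocal d X) a
  rwa [one_mul] at this

variable {d}

theorem obs_mono {X Y : Finset Γ} (h : X ≤ Y) : obs d X ≤ obs d Y := by
  rintro _ ⟨A, rfl⟩
  exact ⟨embed X Y h A, toObs_embed d h A⟩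

theorem toObs_expectation_of_mem {X : Finset Γ} {a : QuasiLocalAlg d} (ha : a ∈ obs d X) :
    toObs d X (expectation d X a) = a := by
  obtain ⟨A, rfl⟩ := ha
  change toObs d X (expectation d X (toObs d X A)) = toObs d X A
  rw [expectation_toObs d le_rfl, restrict_refl]

theorem commute_of_disjoint {X Y : Finset Γ} (h : Disjoint X Y) {a b : QuasiLocalAlg d}
    (ha : a ∈ obs d X) (hb : b ∈ obs d Y) : Commute a b := by
  obtain ⟨A, rfl⟩ := ha
  obtain ⟨B, rfl⟩ := hb
  change Commute (toObs d X A) (toObs d Y B)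
  rw [← toObs_embed d (Finset.subset_union_left (s₂ := Y)) A,
    ← toObs_embed d (Finset.subset_union_right (s₁ := X)) B]
  have := commute_embed (Finset.subset_union_left (s₂ := Y)) (Finset.subset_union_right (s₁ := X))
    h A B
  rw [Commute, SemiconjBy, ← map_mul, ← map_mul, this.eq]

theorem exists_eq_algebraMap_of_mem_obs_empty {a : QuasiLocalAlg d} (ha : a ∈ obs d ∅) :
    ∃ z : ℂ, a = algebraMap ℂ _ z := by
  obtain ⟨A, rfl⟩ := ha
  have : IsEmpty (∅ : Finset Γ) := ⟨fun x => Finset.notMem_empty _ x.2⟩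
  refine ⟨A default default, ?_⟩
  have hA : A = algebraMap ℂ (MatrixAlg d ∅) (A default default) := by
    ext σ τ
    rw [Subsingleton.elim σ default, Subsingleton.elim τ default]
    simp [Matrix.algebraMap_matrix_apply]
  conv_lhs => rw [hA]
  exact AlgHomClass.commutes (toObs d ∅) _

theorem exists_toObs_near (X : Finset Γ) (a : QuasiLocalAlg d) {ε : ℝ} (hε : 0 < ε) :
    ∃ (Z : Finset Γ) (_ : X ≤ Z) (T : MatrixAlg d Z), ‖a - toObs d Z T‖ < ε := by
  obtain ⟨b, hb⟩ := (denseRange_toQuasiLocal d).exists_dist_lt a hε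
  induction b using LocalAlg.induction with
  | h Z T =>
    refine ⟨X ∪ Z, Finset.subset_union_left, embed Z _ Finset.subset_union_right T, ?_⟩
    rw [toObs_embed, ← dist_eq_norm]
    exact hb

/-- An element that almost commutes with the observables of all regions outside `X` is close to
its conditional expectation onto `X`. -/
theorem norm_sub_toObs_expectation_le (X : Finset Γ) (a : QuasiLocalAlg d) (K : ℝ)
    (hK : ∀ Y : Finset Γ, Disjoint Y X → ∀ b ∈ obs d Y, ‖b‖ ≤ 1 → ‖b * a - a * b‖ ≤ K) :
    ‖a - toObs d X (expectation d X a)‖ ≤ K := by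
  refine le_of_forall_pos_le_add fun ε hε => ?_
  obtain ⟨Z, hXZ, T, hT⟩ := exists_toObs_near X a (show 0 < ε / 4 by positivity)
  have hloc : ‖T - embed X Z hXZ (restrict hXZ T)‖ ≤ K + 2 * (ε / 4) := by
    have hw : ∀ w : Conf d (Z \ X) × AddChar (Conf d (Z \ X)) ℂ,
        embed (Z \ X) Z Finset.sdiff_subset (weyl w.1 w.2) ∈ unitary (MatrixAlg d Z) :=
      fun w => embed_weyl_mem_unitary _ w.1 w.2
    rw [embed_restrict]
    refine (norm_average_unitary _ hw T).2 _ fun w => ?_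
    set u := toObs d (Z \ X) (weyl w.1 w.2) with hu
    have hu1 : ‖u‖ ≤ 1 := by
      rw [hu, norm_toObs]
      exact (CStarRing.norm_of_mem_unitary (weyl_mem_unitary w.1 w.2)).le
    have hua := hK (Z \ X) Finset.sdiff_disjoint u ⟨_, rfl⟩ hu1
    rw [← norm_toObs d Z, map_sub, map_mul, map_mul, toObs_embed, ← hu]
    have : u * toObs d Z T - toObs d Z T * u =
        (u * a - a * u) - (u * (a - toObs d Z T) - (a - toObs d Z T) * u) := by noncomm_ring
    rw [this]
    have h₁ : ‖u * (a - toObs d Z T)‖ ≤ 1 * (ε / 4) := norm_mul_le_of_le hu1 hT.le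
    have h₂ : ‖(a - toObs d Z T) * u‖ ≤ (ε / 4) * 1 := norm_mul_le_of_le hT.le hu1
    have h₃ := norm_sub_le (u * a - a * u) (u * (a - toObs d Z T) - (a - toObs d Z T) * u)
    have h₄ := norm_sub_le (u * (a - toObs d Z T)) ((a - toObs d Z T) * u)
    linarith
  have hsplit : a - toObs d X (expectation d X a) = (a - toObs d Z T) +
      toObs d Z (T - embed X Z hXZ (restrict hXZ T)) -
      toObs d X (expectation d X (a - toObs d Z T)) := by
    rw [map_sub (toObs d Z), toObs_embed, map_sub (expectation d X), expectation_toObs d hXZ,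
      map_sub (toObs d X)]
    abel
  have h₁ : ‖toObs d X (expectation d X (a - toObs d Z T))‖ ≤ ε / 4 := by
    rw [norm_toObs]
    exact (norm_expectation_le d X _).trans hT.le
  rw [hsplit]
  refine (norm_sub_le _ _).trans ?_
  have h₂ := norm_add_le (a - toObs d Z T) (toObs d Z (T - embed X Z hXZ (restrict hXZ T)))
  rw [norm_toObs] at h₂
  linarith

end Expectation

/-! ### Time evolutions and locality -/

section Dynamics

variable {Γ : Type*} [DecidableEq Γ] {d : Γ → ℕ} [∀ x, NeZero (d x)] {Φ : Interaction d}

namespace TimeEvolution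

theorem norm_aut (τ : TimeEvolution Φ) (t : ℝ) (a : QuasiLocalAlg d) : ‖τ.aut t a‖ = ‖a‖ :=
  NonUnitalStarAlgHom.norm_map (τ.aut t) (τ.aut t).injective a

/-- By the group law the derivative at `t` is `τ_t` of the derivative at `0`. -/
theorem differentiable_aut (τ : TimeEvolution Φ) {X : Finset Γ} {a : QuasiLocalAlg d}
    (ha : a ∈ obs d X) : Differentiable ℝ fun t => τ.aut t a := by
  intro t
  obtain ⟨D, -, hD⟩ := τ.generator X a ha
  let L : QuasiLocalAlg d →L[ℝ] QuasiLocalAlg d :=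
    LinearMap.mkContinuous
      { toFun := τ.aut t
        map_add' := map_add (τ.aut t)
        map_smul' := fun r b => by
          rw [RingHom.id_apply, ← Complex.coe_smul, ← Complex.coe_smul, map_smul] }
      1 fun b => by rw [one_mul]; exact (τ.norm_aut t b).le
  have h₁ : DifferentiableAt ℝ (fun s => L (τ.aut (s - t) a)) t := by
    refine L.differentiableAt.comp t (DifferentiableAt.comp t (g := fun s => τ.aut s a) ?_
      (differentiableAt_id.sub_const t))
    simpa using hD.differentiableAt
  refine h₁.congr_of_eventuallyEq (Filter.Eventually.of_forall fun s => ?_)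
  change τ.aut s a = τ.aut t (τ.aut (s - t) a)
  rw [← τ.aut_add, add_sub_cancel]

/-- The commutator is invariant under the time evolution, so that evolving one observable forward
amounts to evolving the other one backward. -/
theorem norm_commutator_aut_comm (τ : TimeEvolution Φ) (a b : QuasiLocalAlg d) (t : ℝ) :
    ‖b * τ.aut t a - τ.aut t a * b‖ = ‖a * τ.aut (-t) b - τ.aut (-t) b * a‖ := by
  have hb : τ.aut t (τ.aut (-t) b) = b := by rw [← τ.aut_add, add_neg_cancel, τ.aut_zero]
  rw [← τ.norm_aut t (a * _ - _), map_sub, map_mul, map_mul, hb, norm_sub_rev]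

end TimeEvolution

end Dynamics

section Locality

open scoped Matrix.Norms.L2Operator

variable {Γ : Type*} [MetricSpace Γ]

theorem setDist_comm (X Y : Finset Γ) : setDist X Y = setDist Y X := by
  unfold setDist
  rw [← (Equiv.prodComm X Y).iInf_comp]
  exact iInf_congr fun p => dist_comm _ _

theorem setDist_le_dist {X Y : Finset Γ} {x y : Γ} (hx : x ∈ X) (hy : y ∈ Y) :
    setDist X Y ≤ dist x y :=
  ciInf_le (f := fun p : X × Y => dist (p.1 : Γ) (p.2 : Γ))
    ⟨0, by rintro _ ⟨p, rfl⟩; exact dist_nonneg⟩ (⟨x, hx⟩, ⟨y, hy⟩)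

variable [PolynomialGrowth Γ]

theorem subset_ball {r : ℝ} (hr : 0 < r) (X : Finset Γ) : X ⊆ ball r X :=
  fun x hx => mem_ball.2 ⟨x, hx, by rwa [dist_self]⟩

theorem disjoint_ball_setDist (X Y : Finset Γ) : Disjoint (ball (setDist X Y) X) Y := by
  refine Finset.disjoint_left.2 fun y hy hyY => ?_
  obtain ⟨x, hx, hxy⟩ := mem_ball.1 hy
  rw [dist_comm] at hxy
  exact (setDist_le_dist hx hyY).not_gt hxy

theorem le_setDist_of_disjoint_ball {r : ℝ} {X Y : Finset Γ} (hX : X.Nonempty) (hY : Y.Nonempty)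
    (h : Disjoint Y (ball r X)) : r ≤ setDist X Y := by
  have : Nonempty X := hX.to_subtype
  have : Nonempty Y := hY.to_subtype
  refine le_ciInf fun p => le_of_not_gt fun hp => ?_
  rw [dist_comm] at hp
  exact Finset.disjoint_left.1 h p.2.2 (mem_ball.2 ⟨_, p.1.2, hp⟩)

variable [DecidableEq Γ] {d : Γ → ℕ} [∀ x, NeZero (d x)] {Φ : Interaction d}

namespace TimeEvolution

/-- The local approximation of `τ_t(A)` is its conditional expectation onto `B_r(X)`. -/
theorem LiebRobinsonWith.approxLocalWith {τ : TimeEvolution Φ} {c μ v : ℝ} (hc : 0 < c)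
    (hμ : 0 < μ) (hv : 0 < v) (h : τ.LiebRobinsonWith c μ v) :
    τ.ApproxLocalWith c (μ / 2) v := by
  intro X A hA r hr
  rcases X.eq_empty_or_nonempty with rfl | hX
  · obtain ⟨z, rfl⟩ := exists_eq_algebraMap_of_mem_obs_empty hA
    refine ⟨fun _ => algebraMap ℂ _ z, fun _ => algebraMap_mem _ z, differentiable_const _, rfl,
      fun t => ?_⟩
    rw [AlgHomClass.commutes, sub_self, norm_zero, Finset.card_empty, Nat.cast_zero]
    simp
  · set B := ball r X
    let E : QuasiLocalAlg d →L[ℝ] QuasiLocalAlg d :=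
      ((LinearMap.mkContinuous (toObs d B).toAlgHom.toLinearMap 1 fun T => by
        rw [one_mul]; exact (norm_toObs d B T).le).comp (expectation d B)).restrictScalars ℝ
    have hE : ∀ a, E a = toObs d B (expectation d B a) := fun _ => rfl
    refine ⟨fun t => E (τ.aut t A), fun t => ⟨_, rfl⟩,
      E.differentiable.comp (τ.differentiable_aut hA), ?_, fun t => ?_⟩
    · change E (τ.aut 0 A) = A
      rw [τ.aut_zero, hE, toObs_expectation_of_mem (obs_mono (subset_ball hr X) hA)]
    have hexp : 0 ≤ Real.exp (v * |t|) - 1 :=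
      sub_nonneg.2 (Real.one_le_exp (mul_nonneg hv.le (abs_nonneg t)))
    change ‖τ.aut t A - E (τ.aut t A)‖ ≤ _
    rw [hE]
    refine norm_sub_toObs_expectation_le B _ _ fun Y hY b hb hb1 => ?_
    rcases Y.eq_empty_or_nonempty with rfl | hYne
    · obtain ⟨z, rfl⟩ := exists_eq_algebraMap_of_mem_obs_empty hb
      rw [(Algebra.commutes z (τ.aut t A)), sub_self, norm_zero]
      positivity
    · have hrl : r ≤ setDist X Y := le_setDist_of_disjoint_ball hX hYne hY
      refine (h X Y (hr.trans_le hrl) A hA b hb t).trans ?_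
      have h₁ : Real.exp (-μ * setDist X Y) ≤ Real.exp (-2 * (μ / 2) * r) := by
        refine Real.exp_le_exp.2 ?_
        nlinarith
      have h₂ : c * ‖A‖ * ‖b‖ ≤ c * ‖A‖ := mul_le_of_le_one_right (by positivity) hb1
      have h₃ : min (X.card : ℝ) (Y.card : ℝ) ≤ X.card := min_le_left _ _
      gcongr

/-- Subtracting an observable that commutes with `B` does not change the commutator with `B`. -/
theorem ApproxLocalWith.norm_commutator_le {τ : TimeEvolution Φ} {c μ v : ℝ} (hc : 0 < c)
    (hμ : 0 < μ) (hv : 0 < v) (h : τ.ApproxLocalWith c μ v) {X Y : Finset Γ}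
    (hXY : 0 < setDist X Y) {A B : QuasiLocalAlg d} (hA : A ∈ obs d X) (hB : B ∈ obs d Y) (t : ℝ) :
    ‖B * τ.aut t A - τ.aut t A * B‖ ≤
      2 * c * ‖A‖ * ‖B‖ * (X.card : ℝ) * Real.exp (-μ * setDist X Y) *
        (Real.exp (v * |t|) - 1) := by
  obtain ⟨Ar, hAr, -, -, hbound⟩ := h X A hA _ hXY
  have hcomm : Ar t * B = B * Ar t := commute_of_disjoint (disjoint_ball_setDist X Y) (hAr t) hB
  have heq : B * τ.aut t A - τ.aut t A * B =
      B * (τ.aut t A - Ar t) - (τ.aut t A - Ar t) * B := by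
    rw [mul_sub, sub_mul, hcomm]
    abel
  have hexp : 0 ≤ Real.exp (v * |t|) - 1 :=
    sub_nonneg.2 (Real.one_le_exp (mul_nonneg hv.le (abs_nonneg t)))
  have hdecay : Real.exp (-2 * μ * setDist X Y) ≤ Real.exp (-μ * setDist X Y) := by
    refine Real.exp_le_exp.2 ?_
    nlinarith
  calc ‖B * τ.aut t A - τ.aut t A * B‖
      ≤ ‖B‖ * ‖τ.aut t A - Ar t‖ + ‖τ.aut t A - Ar t‖ * ‖B‖ := by
        rw [heq]
        exact (norm_sub_le _ _).trans (add_le_add (norm_mul_le _ _) (norm_mul_le _ _))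
    _ = 2 * ‖B‖ * ‖τ.aut t A - Ar t‖ := by ring
    _ ≤ 2 * ‖B‖ * (c * ‖A‖ * (X.card : ℝ) * Real.exp (-μ * setDist X Y) *
        (Real.exp (v * |t|) - 1)) := by
        refine mul_le_mul_of_nonneg_left ((hbound t).trans ?_) (by positivity)
        gcongr
    _ = _ := by ring

theorem ApproxLocalWith.liebRobinsonWith {τ : TimeEvolution Φ} {c μ v : ℝ} (hc : 0 < c)
    (hμ : 0 < μ) (hv : 0 < v) (h : τ.ApproxLocalWith c μ v) :
    τ.LiebRobinsonWith (2 * c) μ v := by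
  intro X Y hXY A hA B hB t
  rcases le_total (X.card : ℝ) (Y.card : ℝ) with hle | hle
  · rw [min_eq_left hle]
    exact h.norm_commutator_le hc hμ hv hXY hA hB t
  · rw [min_eq_right hle, τ.norm_commutator_aut_comm, setDist_comm]
    rw [setDist_comm] at hXY
    refine (h.norm_commutator_le hc hμ hv hXY hB hA (-t)).trans_eq ?_
    rw [abs_neg]
    ring

end TimeEvolution

end Locality

end SpinSystem

end

theorem mainTheorem2 {Γ : Type*} [MetricSpace Γ] [DiscreteTopology Γ] [Infinite Γ]
    [DecidableEq Γ] [SpinSystem.PolynomialGrowth Γ]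
    (d : Γ → ℕ) [∀ x, NeZero (d x)]
    (Φ : SpinSystem.Interaction d) (τ : SpinSystem.TimeEvolution Φ) :
    (τ.LiebRobinson ↔ τ.ApproxLocal) ∧
    (∀ c μ v : ℝ, 0 < c → 0 < μ → 0 < v →
      τ.LiebRobinsonWith c μ v → τ.ApproxLocalWith c (μ / 2) v) ∧
    (∀ c μ v : ℝ, 0 < c → 0 < μ → 0 < v →
      τ.ApproxLocalWith c μ v → τ.LiebRobinsonWith (2 * c) μ v) := by
  refine ⟨⟨?_, ?_⟩, fun c μ v hc hμ hv h => h.approxLocalWith hc hμ hv,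
    fun c μ v hc hμ hv h => h.liebRobinsonWith hc hμ hv⟩
  · rintro ⟨c, μ, v, hc, hμ, hv, h⟩
    exact ⟨c, μ / 2, v, hc, half_pos hμ, hv, h.approxLocalWith hc hμ hv⟩
  · rintro ⟨c, μ, v, hc, hμ, hv, h⟩
    exact ⟨2 * c, μ, v, by positivity, hμ, hv, h.liebRobinsonWith hc hμ hv⟩
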